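/- Let $G$ be a finite group and let $\chi$ be an irreducible complex character of $G$. Write $\ker(\chi)=\{g\in G:\chi(g)=\chi(1)\}$, $Z(\chi)=\{g\in G:|\chi(g)|=\chi(1)\}$ and $[g,x]=g^{-1}x^{-1}gx$. For a normal subgroup $N$ of a finite group $H$, an irreducible character $\psi$ of $H$ is called fully ramified over $N$ if the restriction $\psi_N$ is homogeneous (i.e. $\psi_N=e\theta$ for some irreducible character $\theta$ of $N$ and some positive integer $e$) and $\psi(h)=0$ for every $h\in H\setminus N$. The character $\chi$ is said to have central type if $\chi$, viewed as a character of $G/\ker(\chi)$, is fully ramified over the center $Z(G/\ker(\chi))$. Then $\chi$ has central type if and only if for every element $g\in G\setminus Z(\chi)$ there exists an element $x\in G$ such that $[g,x]\in Z(\chi)\setminus\ker(\chi)$. -/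

import Mathlib

/-- `χ ∈ Irr(G)`: a complex-valued function on `G` that is the character of some irreducible
finite-dimensional complex representation of `G`. -/
structure IrrChar (G : Type*) [Group G] where
  toFun : G → ℂ
  exists_rep : ∃ (n : ℕ) (ρ : Representation ℂ G (Fin n → ℂ)),
    ρ.IsIrreducible ∧ ρ.character = toFun

namespace IrrChar

instance {G : Type*} [Group G] : CoeFun (IrrChar G) (fun _ => G → ℂ) := ⟨IrrChar.toFun⟩

open Polynomial in
/-- Helper: an endomorphism of finite order whose trace is the dimension is the identity. -/
theorem eq_one_of_trace_eq {V : Type*} [AddCommGroup V] [Module ℂ V] [FiniteDimensional ℂ V]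
    (f : Module.End ℂ V) (n : ℕ) (hn : n ≠ 0) (hf : f ^ n = 1)
    (htr : LinearMap.trace ℂ V f = Module.finrank ℂ V) : f = 1 := by
  have hs : f.charpoly.Splits := IsAlgClosed.splits _
  rw [Module.End.trace_eq_sum_roots_charpoly_of_splits hs] at htr
  have hnorm : ∀ μ ∈ f.charpoly.roots, ‖μ‖ = 1 := by
    intro μ hμ
    have hev : f.HasEigenvalue μ :=
      (Module.End.hasEigenvalue_iff_isRoot_charpoly f μ).2 (isRoot_of_mem_roots hμ)
    obtain ⟨v, hv⟩ := hev.exists_hasEigenvector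
    have h1 := hv.pow_apply n
    rw [hf, Module.End.one_apply] at h1
    have h2 : (μ ^ n - 1) • v = 0 := by rw [sub_smul, ← h1, one_smul, sub_self]
    have h3 : μ ^ n = 1 := sub_eq_zero.1 ((smul_eq_zero.1 h2).resolve_right hv.2)
    exact Complex.norm_eq_one_of_pow_eq_one h3 hn
  have hcard : Multiset.card f.charpoly.roots = Module.finrank ℂ V := by
    rw [← hs.natDegree_eq_card_roots, LinearMap.charpoly_natDegree]
  have key : ∀ s : Multiset ℂ, (∀ μ ∈ s, ‖μ‖ = 1) →
      s.sum.re ≤ Multiset.card s ∧ (s.sum.re = Multiset.card s → ∀ μ ∈ s, μ = 1) := by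
    intro s
    induction s using Multiset.induction_on with
    | empty => simp
    | cons a s ih =>
      intro h
      obtain ⟨h1, h2⟩ := ih fun μ hμ => h μ (Multiset.mem_cons_of_mem hμ)
      have ha := h a (Multiset.mem_cons_self a s)
      have hre : a.re ≤ 1 := ha ▸ Complex.re_le_norm a
      simp only [Multiset.sum_cons, Complex.add_re, Multiset.card_cons, Nat.cast_add, Nat.cast_one]
      refine ⟨by linarith, fun he μ hμ => ?_⟩
      rcases Multiset.mem_cons.1 hμ with rfl | hμ
      · have hre1 : μ.re = 1 := by linarith
        have hsq := Complex.sq_norm μ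
        rw [ha, Complex.normSq_apply, hre1] at hsq
        have him : μ.im = 0 := by nlinarith
        exact Complex.ext (by simpa using hre1) (by simpa using him)
      · exact h2 (by linarith) μ hμ
  have hone : ∀ μ ∈ f.charpoly.roots, μ = 1 := by
    refine (key _ hnorm).2 ?_
    rw [htr, hcard]
    simp
  have hpoly : f.charpoly = (X - C 1) ^ Module.finrank ℂ V := by
    have h := hs.eq_prod_roots
    rw [Multiset.eq_replicate.2 ⟨hcard, hone⟩, (LinearMap.charpoly_monic f).leadingCoeff] at h
    simpa using h
  have hnil : IsNilpotent (f - 1) := by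
    refine ⟨Module.finrank ℂ V, ?_⟩
    have h := LinearMap.aeval_self_charpoly f
    rw [hpoly] at h
    simpa using h
  have hsep : ((X : ℂ[X]) ^ n - C 1).Separable :=
    separable_X_pow_sub_C 1 (by exact_mod_cast hn) one_ne_zero
  have hss : f.IsSemisimple :=
    Module.End.isSemisimple_of_squarefree_aeval_eq_zero hsep.squarefree (by simp [hf])
  have hss1 : (f - 1).IsSemisimple := by
    have h := (Module.End.isSemisimple_sub_algebraMap_iff (f := f) (μ := (1 : ℂ))).2 hss
    rwa [map_one] at h
  exact sub_eq_zero.1 (Module.End.eq_zero_of_isNilpotent_isSemisimple hnil hss1)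

/-- Helper: `χ g = χ 1` exactly when `g` acts trivially in a representation affording `χ`. -/
theorem character_eq_iff {G : Type*} [Group G] [Finite G] {V : Type*} [AddCommGroup V]
    [Module ℂ V] [FiniteDimensional ℂ V] (ρ : Representation ℂ G V) (g : G) :
    ρ.character g = ρ.character 1 ↔ ρ g = 1 := by
  constructor
  · intro h
    rw [Representation.char_one] at h
    refine eq_one_of_trace_eq (ρ g) (orderOf g) (orderOf_pos g).ne' ?_ h
    rw [← map_pow, pow_orderOf_eq_one, map_one]
  · intro h
    simp [Representation.character, h]

/-- The kernel `ker χ = {g ∈ G : χ(g) = χ(1)}`. -/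
def ker {G : Type*} [Group G] [Finite G] (χ : IrrChar G) : Subgroup G where
  carrier := {g | χ g = χ 1}
  one_mem' := rfl
  mul_mem' := by
    obtain ⟨χ, n, ρ, -, rfl⟩ := χ
    intro a b ha hb
    simp only [Set.mem_ofPred_eq, character_eq_iff] at ha hb ⊢
    rw [map_mul, ha, hb, one_mul]
  inv_mem' := by
    obtain ⟨χ, n, ρ, -, rfl⟩ := χ
    intro a ha
    simp only [Set.mem_ofPred_eq, character_eq_iff] at ha ⊢
    have h : ρ (a * a⁻¹) = 1 := by rw [mul_inv_cancel, map_one]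
    rwa [map_mul, ha, one_mul] at h

instance {G : Type*} [Group G] [Finite G] (χ : IrrChar G) : χ.ker.Normal where
  conj_mem := by
    obtain ⟨χ, n, ρ, -, rfl⟩ := χ
    intro a ha g
    change ρ.character (g * a * g⁻¹) = ρ.character 1
    rw [Representation.char_conj]
    exact ha

/-- The center of the character, `Z(χ) = {g ∈ G : |χ(g)| = χ(1)}`. -/
def center {G : Type*} [Group G] (χ : IrrChar G) : Set G :=
  {g | ((‖χ g‖ : ℝ) : ℂ) = χ 1}

/-- `χ` considered as an irreducible character of `G / ker χ`, namely `g ker χ ↦ χ(g)`. -/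
def deflate {G : Type*} [Group G] [Finite G] (χ : IrrChar G) : IrrChar (G ⧸ χ.ker) where
  toFun := Quotient.lift χ.toFun (by
    obtain ⟨χ, n, ρ, hρ, rfl⟩ := χ
    intro a b hab
    have h : ρ.character (a⁻¹ * b) = ρ.character 1 := QuotientGroup.leftRel_apply.1 hab
    rw [character_eq_iff] at h
    have hb : ρ b = ρ a := by
      rw [← mul_inv_cancel_left a b, map_mul, h, mul_one]
    simp [Representation.character, hb])
  exists_rep := by
    obtain ⟨χ, n, ρ, hρ, rfl⟩ := χ
    refine ⟨n, QuotientGroup.lift _ ρ (fun g hg => (character_eq_iff ρ g).1 hg), ?_, ?_⟩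
    · refine (OrderIso.isSimpleOrder_iff (β := Subrepresentation ρ)
        { toFun := fun W => ⟨W.toSubmodule, fun g v hv =>
            W.apply_mem_toSubmodule (QuotientGroup.mk g) hv⟩
          invFun := fun W => ⟨W.toSubmodule, fun q v hv => by
            induction q using QuotientGroup.induction_on with
            | H g => exact W.apply_mem_toSubmodule g hv⟩
          left_inv := fun W => rfl
          right_inv := fun W => rfl
          map_rel_iff' := Iff.rfl }).2 hρ
    · funext q
      induction q using QuotientGroup.induction_on with
      | H g => rfl

/-- The restriction `χ_N` is homogeneous: `χ_N = e θ` for some `θ ∈ Irr(N)` and `e ∈ ℕ`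
(necessarily `e > 0`, since `χ(1) ≠ 0`). -/
def IsHomogeneousOn {G : Type*} [Group G] (χ : IrrChar G) (N : Subgroup G) : Prop :=
  ∃ (θ : IrrChar N) (e : ℕ), ∀ n : N, χ (n : G) = (e : ℂ) * θ n

/-- `χ` is fully ramified over the normal subgroup `N`: `χ_N` is homogeneous and `χ` vanishes
on `G \ N`. -/
def IsFullyRamifiedOver {G : Type*} [Group G] (χ : IrrChar G) (N : Subgroup G) [N.Normal] : Prop :=
  χ.IsHomogeneousOn N ∧ ∀ g : G, g ∉ N → χ g = 0

/-- `χ` has central type: considered as a character of `G / ker χ`, it is fully ramified over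
the center `Z(G / ker χ)`. -/
def HasCentralType {G : Type*} [Group G] [Finite G] (χ : IrrChar G) : Prop :=
  χ.deflate.IsFullyRamifiedOver (Subgroup.center (G ⧸ χ.ker))

end IrrChar

/-! Let `ρ` afford `χ`. Equality in the triangle inequality for eigenvalues shows that `Z(χ)`
consists of the elements acting as scalars. By Schur it is the preimage of the center of `G / ker
χ`, over which `χ` is automatically homogeneous, so central type means that `χ` vanishes off `Z(χ)`.
If `[g, x]` acts as a scalar `c ≠ 1`, then `χ(g) = χ(x⁻¹gx) = c χ(g)`, so `χ(g) = 0`. Conversely, if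
`χ` vanishes off `Z(χ)` and `g ∉ Z(χ)`, the sum of the conjugates of `g` is a scalar of trace zero,
hence zero. Multiplying by `g⁻¹` and taking traces gives `∑ χ([g, x]) = 0`. Without a nontrivial
scalar commutator each term would be `0` or `χ(1)`, and `x = 1` contributes `χ(1) > 0`. -/

theorem Multiset.eq_of_sum_eq_card_mul (s : Multiset ℂ) (hs : ∀ μ ∈ s, ‖μ‖ = 1) (c : ℂ)
    (hc : ‖c‖ = 1) (h : s.sum = s.card * c) : ∀ μ ∈ s, μ = c := by
  -- Multiplying by `star c = c⁻¹` rotates `c` to `1`, leaving real parts that are each at most `1`.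
  -- The inequality is part of the induction because it splits an equality between head and tail.
  have key : ∀ s : Multiset ℂ, (∀ μ ∈ s, ‖μ‖ = 1) →
      (s.sum * star c).re ≤ s.card ∧ ((s.sum * star c).re = s.card → ∀ μ ∈ s, μ = c) := by
    intro s
    induction s using Multiset.induction_on with
    | empty => simp
    | cons a s ih =>
      intro h
      obtain ⟨h1, h2⟩ := ih fun μ hμ => h μ (Multiset.mem_cons_of_mem hμ)
      have ha : ‖a * star c‖ = 1 := by
        rw [norm_mul, norm_star, h a (Multiset.mem_cons_self a s), hc, one_mul]
      have hre : (a * star c).re ≤ 1 := ha ▸ Complex.re_le_norm _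
      simp only [Multiset.sum_cons, add_mul, Complex.add_re, Multiset.card_cons, Nat.cast_add,
        Nat.cast_one]
      refine ⟨by linarith, fun he μ hμ => ?_⟩
      rcases Multiset.mem_cons.1 hμ with rfl | hμ
      · have hre1 : (μ * star c).re = ‖μ * star c‖ := by linarith
        have h4 : μ * star c = 1 := by
          have h5 := (Complex.re_eq_norm.1 hre1)
          rw [Complex.eq_re_of_ofReal_le (r := 0) h5, hre1, ha, Complex.ofReal_one]
        have h6 : star c * c = 1 := by
          rw [mul_comm, Complex.star_def, Complex.mul_conj']
          simp [hc]
        calc μ = μ * (star c * c) := by rw [h6, mul_one]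
          _ = c := by rw [← mul_assoc, h4, one_mul]
      · exact h2 (by linarith) μ hμ
  refine (key s hs).2 ?_
  rw [h, mul_assoc, Complex.star_def, Complex.mul_conj']
  simp [hc]

namespace Module.End

variable {V : Type*} [AddCommGroup V] [Module ℂ V] [FiniteDimensional ℂ V]

/-- An endomorphism of finite order whose trace has absolute value the dimension is a scalar. -/
theorem eq_smul_one_of_norm_trace_eq (f : Module.End ℂ V) (n : ℕ) (hn : n ≠ 0) (hf : f ^ n = 1)
    (htr : ‖LinearMap.trace ℂ V f‖ = Module.finrank ℂ V) : ∃ c : ℂ, f = c • 1 := by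
  rcases subsingleton_or_nontrivial V with hV | hV
  · exact ⟨0, Subsingleton.elim _ _⟩
  set d := Module.finrank ℂ V with hd
  have hd0 : (d : ℂ) ≠ 0 := Nat.cast_ne_zero.2 Module.finrank_pos.ne'
  have hs : f.charpoly.Splits := IsAlgClosed.splits _
  have hroot : ∀ μ ∈ f.charpoly.roots, μ ^ n = 1 := by
    intro μ hμ
    have hev : f.HasEigenvalue μ :=
      (Module.End.hasEigenvalue_iff_isRoot_charpoly f μ).2 (Polynomial.isRoot_of_mem_roots hμ)
    obtain ⟨v, hv⟩ := hev.exists_hasEigenvector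
    have h1 := hv.pow_apply n
    rw [hf, Module.End.one_apply] at h1
    have h2 : (μ ^ n - 1) • v = 0 := by rw [sub_smul, ← h1, one_smul, sub_self]
    exact sub_eq_zero.1 ((smul_eq_zero.1 h2).resolve_right hv.2)
  have hcard : Multiset.card f.charpoly.roots = d := by
    rw [← hs.natDegree_eq_card_roots, LinearMap.charpoly_natDegree]
  obtain ⟨c, hc⟩ : ∃ c : ℂ, LinearMap.trace ℂ V f = d * c :=
    ⟨LinearMap.trace ℂ V f / d, (mul_div_cancel₀ _ hd0).symm⟩
  have hc1 : ‖c‖ = 1 := by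
    rw [hc, norm_mul, Complex.norm_natCast] at htr
    have hd0' : (d : ℝ) ≠ 0 := by exact_mod_cast hd0
    exact mul_left_cancel₀ hd0' (by rw [htr, mul_one])
  have hall : ∀ μ ∈ f.charpoly.roots, μ = c :=
    Multiset.eq_of_sum_eq_card_mul _
      (fun μ hμ => Complex.norm_eq_one_of_pow_eq_one (hroot μ hμ) hn) c hc1 (by
        rw [hcard, ← hc, Module.End.trace_eq_sum_roots_charpoly_of_splits hs])
  obtain ⟨μ, hμ⟩ : ∃ μ, μ ∈ f.charpoly.roots :=
    Multiset.card_pos_iff_exists_mem.1 (hcard ▸ Module.finrank_pos)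
  have hcn : c ^ n = 1 := hall μ hμ ▸ hroot μ hμ
  have hc0 : c ≠ 0 := norm_ne_zero_iff.1 (by rw [hc1]; exact one_ne_zero)
  -- Dividing by `c` makes the trace equal to the dimension and keeps the order finite.
  have h := IrrChar.eq_one_of_trace_eq (c⁻¹ • f) n hn
    (by rw [smul_pow, hf, inv_pow, hcn, inv_one, one_smul])
    (by rw [map_smul, hc, smul_eq_mul, mul_left_comm, inv_mul_cancel₀ hc0, mul_one])
  exact ⟨c, by rw [← h, smul_inv_smul₀ hc0]⟩

end Module.End

/-! ### Scalar action and commutators -/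

namespace Representation

section Schur

variable {k G V : Type*} [Field k] [IsAlgClosed k] [Monoid G] [AddCommGroup V] [Module k V]
  [FiniteDimensional k V]

/-- Schur's lemma. -/
theorem IsIrreducible.eq_smul_one_of_commute {ρ : Representation k G V} (hρ : ρ.IsIrreducible)
    (f : Module.End k V) (hf : ∀ g, f * ρ g = ρ g * f) : ∃ c : k, f = c • 1 := by
  obtain ⟨c, hc⟩ := (algebraMap_intertwiningMap_bijective_of_isAlgClosed (ρ := ρ)).2
    (⟨f, fun g => hf g⟩ : IntertwiningMap ρ ρ)
  refine ⟨c, LinearMap.ext fun v => ?_⟩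
  have := congrArg (fun F : IntertwiningMap ρ ρ => F v) hc
  rw [Algebra.algebraMap_eq_smul_one] at this
  exact this.symm

end Schur

variable {G V : Type*} [Group G] [AddCommGroup V] [Module ℂ V] [FiniteDimensional ℂ V]

theorem IsIrreducible.finrank_ne_zero {ρ : Representation ℂ G V} (hρ : ρ.IsIrreducible) :
    (Module.finrank ℂ V : ℂ) ≠ 0 := by
  have : Nontrivial V := by
    by_contra h
    rw [not_nontrivial_iff_subsingleton] at h
    obtain ⟨W, W', hW⟩ := hρ.toNontrivial
    exact hW (Subrepresentation.toSubmodule_injective (Subsingleton.elim _ _))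
  exact Nat.cast_ne_zero.2 Module.finrank_pos.ne'

variable [Finite G]

/-- `|χ(g)| = χ(1)` exactly when `g` acts as a scalar. -/
theorem norm_character_eq_iff {ρ : Representation ℂ G V} (hρ : ρ.IsIrreducible) (g : G) :
    ((‖ρ.character g‖ : ℝ) : ℂ) = ρ.character 1 ↔ ∃ c : ℂ, ρ g = c • 1 := by
  have hpow : ρ g ^ orderOf g = 1 := by rw [← map_pow, pow_orderOf_eq_one, map_one]
  rw [char_one]
  constructor
  · intro h
    exact Module.End.eq_smul_one_of_norm_trace_eq (ρ g) (orderOf g) (orderOf_pos g).ne' hpow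
      (by exact_mod_cast h)
  · rintro ⟨c, hc⟩
    have hc1 : c ^ orderOf g = 1 := by
      rw [hc, smul_pow, one_pow] at hpow
      have h := congrArg (LinearMap.trace ℂ V) hpow
      rw [map_smul, LinearMap.trace_one, smul_eq_mul] at h
      exact mul_right_cancel₀ hρ.finrank_ne_zero (by rw [h, one_mul])
    have hn := Complex.norm_eq_one_of_pow_eq_one hc1 (orderOf_pos g).ne'
    simp [character, hc, hn]

open scoped ComplexOrder in
/-- Suppose that `χ` vanishes on the elements acting as nonscalars. Then every such `g` has a
commutator `[g, x]` acting as a nontrivial scalar: otherwise the sum of the conjugates of `g`,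
which acts as zero, would have positive trace after multiplication by `g⁻¹`. -/
theorem exists_commutator_scalar {ρ : Representation ℂ G V} (hρ : ρ.IsIrreducible)
    (hvan : ∀ g : G, (¬ ∃ c : ℂ, ρ g = c • 1) → ρ.character g = 0)
    (g : G) (hg : ¬ ∃ c : ℂ, ρ g = c • 1) :
    ∃ x : G, (∃ c : ℂ, ρ (g⁻¹ * x⁻¹ * g * x) = c • 1) ∧ ρ (g⁻¹ * x⁻¹ * g * x) ≠ 1 := by
  by_contra! hcon
  have := Fintype.ofFinite G
  have hd := hρ.finrank_ne_zero
  set T : Module.End ℂ V := ∑ x : G, ρ (x⁻¹ * g * x) with hT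
  have hT0 : T = 0 := by
    obtain ⟨c, hc⟩ := hρ.eq_smul_one_of_commute T (fun h => by
      rw [hT, Finset.sum_mul, Finset.mul_sum]
      -- Right translation by `h` permutes the conjugates, so `T` commutes with `ρ h`.
      refine Fintype.sum_equiv (Equiv.mulRight h) _ _ (fun x => ?_)
      rw [← map_mul, ← map_mul]
      congr 1
      simp only [Equiv.coe_mulRight]
      group)
    have htr : LinearMap.trace ℂ V T = 0 := by
      rw [hT, map_sum]
      refine Finset.sum_eq_zero fun x _ => ?_
      have h := char_conj ρ g x⁻¹
      rw [inv_inv, hvan g hg] at h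
      exact h
    rw [hc, map_smul, LinearMap.trace_one, smul_eq_mul] at htr
    rw [hc, (mul_eq_zero.1 htr).resolve_right hd, zero_smul]
  have hsum : ∑ x : G, ρ.character (g⁻¹ * x⁻¹ * g * x) = 0 := by
    have h : LinearMap.trace ℂ V (ρ g⁻¹ * T) = 0 := by rw [hT0, mul_zero, map_zero]
    rw [hT, Finset.mul_sum, map_sum] at h
    rw [← h]
    refine Finset.sum_congr rfl fun x _ => ?_
    rw [← map_mul, character]
    simp only [mul_assoc]
  -- In the order on `ℂ`, `0 ≤ z` means real and nonnegative, so a zero sum kills every term.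
  have hnn : ∀ x : G, 0 ≤ ρ.character (g⁻¹ * x⁻¹ * g * x) := by
    intro x
    by_cases hx : ∃ c : ℂ, ρ (g⁻¹ * x⁻¹ * g * x) = c • 1
    · rw [character, hcon x hx, LinearMap.trace_one]
      exact Nat.cast_nonneg _
    · rw [hvan _ hx]
  have h1 := (Finset.sum_eq_zero_iff_of_nonneg fun x _ => hnn x).1 hsum 1 (Finset.mem_univ _)
  apply hd
  simpa using h1

/-- If `[g, x]` acts as a nontrivial scalar, then `χ(g) = 0`. -/
theorem character_eq_zero_of_commutator_scalar {k G V : Type*} [Field k] [Group G]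
    [AddCommGroup V] [Module k V] (ρ : Representation k G V) (g x : G) (c : k)
    (hc : ρ (g⁻¹ * x⁻¹ * g * x) = c • 1) (hne : ρ (g⁻¹ * x⁻¹ * g * x) ≠ 1) :
    ρ.character g = 0 := by
  have h1 : ρ (x⁻¹ * g * x⁻¹⁻¹) = c • ρ g := by
    have : x⁻¹ * g * x⁻¹⁻¹ = g * (g⁻¹ * x⁻¹ * g * x) := by group
    rw [this, map_mul, hc, mul_smul_comm, mul_one]
  have h2 := char_conj ρ g x⁻¹
  rw [character, h1, map_smul, smul_eq_mul] at h2
  have hc1 : c - 1 ≠ 0 := fun h => hne (by rw [hc, sub_eq_zero.1 h, one_smul])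
  refine (mul_eq_zero.1 (?_ : (c - 1) * ρ.character g = 0)).resolve_left hc1
  rw [sub_mul, one_mul, sub_eq_zero]
  exact h2

/-- A one-dimensional representation is irreducible. -/
theorem isIrreducible_of_finrank_eq_one {k G V : Type*} [Field k] [Monoid G] [AddCommGroup V]
    [Module k V] (ρ : Representation k G V) (h : Module.finrank k V = 1) : ρ.IsIrreducible := by
  have hs : IsSimpleOrder (Submodule k V) :=
    isSimpleModule_iff _ _ |>.1 (isSimpleModule_iff_finrank_eq_one.2 h)
  refine { exists_pair_ne := ⟨⊥, ⊤, fun h => ?_⟩, eq_bot_or_eq_top := fun W => ?_ }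
  · exact bot_ne_top (congrArg Subrepresentation.toSubmodule h : (⊥ : Submodule k V) = ⊤)
  · rcases hs.eq_bot_or_eq_top W.toSubmodule with h | h
    · exact Or.inl (Subrepresentation.toSubmodule_injective h)
    · exact Or.inr (Subrepresentation.toSubmodule_injective h)

end Representation

/-! ### Central type as vanishing off `Z(χ)` -/

namespace IrrChar

variable {G : Type*} [Group G]

/-- A character restricts homogeneously to a central subgroup. -/
theorem isHomogeneousOn_of_le_center (χ : IrrChar G) (N : Subgroup G)
    (hN : N ≤ Subgroup.center G) : χ.IsHomogeneousOn N := by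
  obtain ⟨χ, n, ρ, hρ, rfl⟩ := χ
  have hscal : ∀ z : N, ∃ c : ℂ, ρ z = c • 1 := fun z =>
    hρ.eq_smul_one_of_commute (ρ z) fun g => by
      rw [← map_mul, ← map_mul, Subgroup.mem_center_iff.1 (hN z.2) g]
  choose c hc using hscal
  have hd := hρ.finrank_ne_zero
  have hinj : ∀ a b : ℂ, a • (1 : Module.End ℂ (Fin n → ℂ)) = b • 1 → a = b := by
    intro a b hab
    have h := congrArg (LinearMap.trace ℂ _) hab
    rw [map_smul, map_smul, LinearMap.trace_one, smul_eq_mul, smul_eq_mul] at h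
    exact mul_right_cancel₀ hd h
  -- The central character; its multiplicity in the restriction is the degree `n`.
  let θ : Representation ℂ N (Fin 1 → ℂ) :=
    { toFun := fun z => c z • 1
      map_one' := by
        rw [hinj (c 1) 1 (by rw [← hc, one_smul, OneMemClass.coe_one, map_one]), one_smul]
      map_mul' := fun a b => by
        rw [hinj (c (a * b)) (c a * c b) (by
          rw [← hc, Subgroup.coe_mul, map_mul, hc, hc, smul_mul_smul_comm, one_mul]),
          smul_mul_smul_comm, one_mul] }
  refine ⟨⟨θ.character, 1, θ, θ.isIrreducible_of_finrank_eq_one (by simp), rfl⟩, n, fun z => ?_⟩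
  have h1 : ρ.character z = c z * n := by
    rw [Representation.character, hc, map_smul, LinearMap.trace_one]
    simp
  have h2 : θ.character z = c z := by
    change LinearMap.trace ℂ _ (c z • 1) = c z
    rw [map_smul, LinearMap.trace_one]
    simp
  change ρ.character z = n * θ.character z
  rw [h1, h2, mul_comm]

variable [Finite G]

/-- `Z(χ) / ker χ` is the center of `G / ker χ`. -/
theorem mk_mem_center_iff (χ : IrrChar G) (g : G) :
    (QuotientGroup.mk g : G ⧸ χ.ker) ∈ Subgroup.center (G ⧸ χ.ker) ↔ g ∈ χ.center := by
  obtain ⟨χ, n, ρ, hρ, rfl⟩ := χ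
  refine Iff.trans ?_ (Representation.norm_character_eq_iff hρ g).symm
  -- Since `ker χ` is the kernel of `ρ`, commuting modulo `ker χ` is commuting under `ρ`.
  have hmk : ∀ x : G, ((QuotientGroup.mk x * QuotientGroup.mk g :
      G ⧸ ker ⟨ρ.character, n, ρ, hρ, rfl⟩) = QuotientGroup.mk g * QuotientGroup.mk x) ↔ ρ g * ρ x = ρ x * ρ g := by
    intro x
    rw [← QuotientGroup.mk_mul, ← QuotientGroup.mk_mul, QuotientGroup.eq]
    refine (character_eq_iff ρ _).trans ?_
    rw [← map_mul ρ g x, ← map_mul ρ x g]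
    constructor
    · intro h
      rw [← mul_one (ρ (x * g)), ← h, ← map_mul, mul_inv_cancel_left]
    · intro h
      rw [map_mul, h, ← map_mul, inv_mul_cancel, map_one]
  rw [Subgroup.mem_center_iff]
  constructor
  · intro h
    exact hρ.eq_smul_one_of_commute _ fun x => (hmk x).1 (h (QuotientGroup.mk x))
  · rintro ⟨c, hc⟩ q
    induction q using QuotientGroup.induction_on with
    | H x => exact (hmk x).2 (by rw [hc, smul_one_mul, mul_smul_one])

/-- `χ` has central type exactly when it vanishes outside `Z(χ)`. -/
theorem hasCentralType_iff (χ : IrrChar G) :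
    χ.HasCentralType ↔ ∀ g : G, g ∉ χ.center → χ g = 0 := by
  constructor
  · intro h g hg
    exact h.2 (QuotientGroup.mk g) (mt (χ.mk_mem_center_iff g).1 hg)
  · intro h
    refine ⟨isHomogeneousOn_of_le_center _ _ le_rfl, fun q hq => ?_⟩
    induction q using QuotientGroup.induction_on with
    | H g => exact h g (mt (χ.mk_mem_center_iff g).2 hq)

end IrrChar

theorem mainTheorem2 {G : Type*} [Group G] [Finite G] (χ : IrrChar G) :
    χ.HasCentralType ↔
      ∀ g : G, g ∉ χ.center → ∃ x : G,
        g⁻¹ * x⁻¹ * g * x ∈ χ.center ∧ g⁻¹ * x⁻¹ * g * x ∉ χ.ker := by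
  rw [IrrChar.hasCentralType_iff]
  obtain ⟨χ, n, ρ, hρ, rfl⟩ := χ
  have hcen : ∀ g : G, g ∈ IrrChar.center ⟨ρ.character, n, ρ, hρ, rfl⟩ ↔ ∃ c : ℂ, ρ g = c • 1 :=
    Representation.norm_character_eq_iff hρ
  have hker : ∀ g : G, g ∈ IrrChar.ker ⟨ρ.character, n, ρ, hρ, rfl⟩ ↔ ρ g = 1 :=
    IrrChar.character_eq_iff ρ
  simp only [hcen, hker]
  constructor
  · exact Representation.exists_commutator_scalar hρ
  · intro h g hg
    obtain ⟨x, ⟨c, hc⟩, hne⟩ := h g hg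
    exact ρ.character_eq_zero_of_commutator_scalar g x c hc hne
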